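/- **Proposition S3.** A one-parameter state $\sigma_\theta$ is a map from reals to matrices that, for all $\theta$ in a neighbourhood of the true parameter value, is differentiable and takes density matrices as values. Its quantum Fisher information (QFI) at the true value is $F(\sigma_\theta)=\mathrm{Tr}(\sigma_\theta L^2)$, where $L$ is any Hermitian operator with $\frac12(L\sigma_\theta+\sigma_\theta L)=\partial_\theta\sigma_\theta$. Let $\mathcal N$ be a qubit channel (a completely positive trace-preserving linear map on $2\times2$ complex matrices) that is strictly contractive, i.e. $\|\mathcal N(A)\|_1<\|A\|_1$ for every nonzero traceless Hermitian $A$, where $\|\cdot\|_1$ is the trace norm. Let $$\eta(\mathcal N):=\sup_{\sigma_\theta}\frac{F(\mathcal N(\sigma_\theta))}{F(\sigma_\theta)},$$ where the supremum is over all one-parameter qubit states $\sigma_\theta$ with $F(\sigma_\theta)\neq0$. The set of these quotients is nonempty and bounded above, and $$\eta(\mathcal N)\;\le\;\max_{\substack{A \text{ Hermitian},\ A\ne0\\ \mathrm{Tr}(A)=0}}\frac{\|\mathcal N(A)\|_1}{\|A\|_1}\;<\;1 ,$$ where the maximum is attained. Moreover, this maximum equals the largest singular value $|\lambda_1|$ of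 the real $3\times3$ Pauli transfer matrix $T_{ij}=\frac12\mathrm{Tr}(\sigma_i\,\mathcal N(\sigma_j))$, $i,j\in\{1,2,3\}$, with $(\sigma_1,\sigma_2,\sigma_3)=(X,Y,Z)$ the Pauli matrices. In particular $\eta(\mathcal N)<1$. -/

import Mathlib

open Matrix Topology
open scoped ComplexOrder

noncomputable section

/-- A density matrix: positive semidefinite with unit trace. -/
def IsDensity {n : ℕ} (ρ : Matrix (Fin n) (Fin n) ℂ) : Prop :=
  ρ.PosSemidef ∧ ρ.trace = 1

/-- The map `id_k ⊗ N` acting on `k × k` block matrices with `2 × 2` blocks. -/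
def ampliate (k : ℕ) (N : Matrix (Fin 2) (Fin 2) ℂ →ₗ[ℂ] Matrix (Fin 2) (Fin 2) ℂ)
    (M : Matrix (Fin k × Fin 2) (Fin k × Fin 2) ℂ) : Matrix (Fin k × Fin 2) (Fin k × Fin 2) ℂ :=
  Matrix.of fun x y => N (Matrix.of fun a b => M (x.1, a) (y.1, b)) x.2 y.2

/-- A qubit channel: a completely positive and trace-preserving linear map on `2 × 2` complex
matrices. -/
structure IsQubitChannel
    (N : Matrix (Fin 2) (Fin 2) ℂ →ₗ[ℂ] Matrix (Fin 2) (Fin 2) ℂ) : Prop where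
  completelyPositive : ∀ (k : ℕ) (M : Matrix (Fin k × Fin 2) (Fin k × Fin 2) ℂ),
    M.PosSemidef → (ampliate k N M).PosSemidef
  tracePreserving : ∀ A : Matrix (Fin 2) (Fin 2) ℂ, (N A).trace = A.trace

/-- The trace norm: the sum of the singular values. -/
def traceNorm {n : ℕ} (A : Matrix (Fin n) (Fin n) ℂ) : ℝ :=
  ∑ i : Fin n, (Matrix.toEuclideanLin A).singularValues i

/-- `N` strictly decreases the trace norm of every nonzero traceless Hermitian operator. -/
def IsStrictlyContractive
    (N : Matrix (Fin 2) (Fin 2) ℂ →ₗ[ℂ] Matrix (Fin 2) (Fin 2) ℂ) : Prop :=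
  ∀ A : Matrix (Fin 2) (Fin 2) ℂ, A.IsHermitian → A.trace = 0 → A ≠ 0 →
    traceNorm (N A) < traceNorm A

/-- The quotients `‖N(A)‖₁ / ‖A‖₁` over the nonzero traceless Hermitian operators `A`. -/
def traceNormRatios
    (N : Matrix (Fin 2) (Fin 2) ℂ →ₗ[ℂ] Matrix (Fin 2) (Fin 2) ℂ) : Set ℝ :=
  {r | ∃ A : Matrix (Fin 2) (Fin 2) ℂ, A.IsHermitian ∧ A.trace = 0 ∧ A ≠ 0 ∧
    r = traceNorm (N A) / traceNorm A}

/-- The contraction coefficient of `N` with respect to the trace distance. -/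
def traceContraction
    (N : Matrix (Fin 2) (Fin 2) ℂ →ₗ[ℂ] Matrix (Fin 2) (Fin 2) ℂ) : ℝ :=
  sSup (traceNormRatios N)

/-- The Pauli matrices `X, Y, Z`. -/
def pauli : Fin 3 → Matrix (Fin 2) (Fin 2) ℂ :=
  ![!![0, 1; 1, 0], !![0, -Complex.I; Complex.I, 0], !![1, 0; 0, -1]]

/-- The `3 × 3` Pauli transfer matrix `T i j = Tr (σᵢ N(σⱼ)) / 2`, `i, j = 1, 2, 3`, so that `N` maps
the Bloch vector `w` to `t + T w`. The trace is real because a channel preserves Hermiticity. -/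
def pauliTransfer
    (N : Matrix (Fin 2) (Fin 2) ℂ →ₗ[ℂ] Matrix (Fin 2) (Fin 2) ℂ) : Matrix (Fin 3) (Fin 3) ℝ :=
  Matrix.of fun i j => ((pauli i * N (pauli j)).trace / 2).re

/-- The (entrywise) derivative of a matrix-valued function. -/
def matDeriv {n : ℕ} (ρ : ℝ → Matrix (Fin n) (Fin n) ℂ) (θ : ℝ) : Matrix (Fin n) (Fin n) ℂ :=
  Matrix.of fun i j => deriv (fun t => ρ t i j) θ

/-- `ρ` is a one-parameter quantum state around the true value `θ₀`: for all parameters near `θ₀`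
it is a density matrix and differentiable. -/
def IsOneParameterState {n : ℕ} (ρ : ℝ → Matrix (Fin n) (Fin n) ℂ) (θ₀ : ℝ) : Prop :=
  ∀ᶠ θ in 𝓝 θ₀, IsDensity (ρ θ) ∧ ∀ i j, DifferentiableAt ℝ (fun t => ρ t i j) θ

/-- `L` is a symmetric logarithmic derivative of `ρ` at `θ`. -/
def IsSLD {n : ℕ} (ρ : ℝ → Matrix (Fin n) (Fin n) ℂ) (θ : ℝ) (L : Matrix (Fin n) (Fin n) ℂ) :
    Prop :=
  L.IsHermitian ∧ (1 / 2 : ℂ) • (L * ρ θ + ρ θ * L) = matDeriv ρ θ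

open Classical in
/-- The quantum Fisher information `Tr (ρ_θ L²)` at `θ`, for any symmetric logarithmic derivative
`L`. The choice of `L` is immaterial (`qfi_eq`), and `L` exists for every one-parameter quantum
state (`exists_isSLD`). -/
def qfi {n : ℕ} (ρ : ℝ → Matrix (Fin n) (Fin n) ℂ) (θ : ℝ) : ℝ :=
  if h : ∃ L, IsSLD ρ θ L then (ρ θ * (h.choose * h.choose)).trace.re else 0

theorem qfi_eq {n : ℕ} {ρ : ℝ → Matrix (Fin n) (Fin n) ℂ} {θ : ℝ}
    {L : Matrix (Fin n) (Fin n) ℂ} (hL : IsSLD ρ θ L) :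
    qfi ρ θ = (ρ θ * (L * L)).trace.re := by
  have key : ∀ L' : Matrix (Fin n) (Fin n) ℂ, IsSLD ρ θ L' →
      (ρ θ * (L' * L')).trace = (ρ θ * (L * L)).trace := by
    intro L' hL'
    have e : L' * ρ θ + ρ θ * L' = L * ρ θ + ρ θ * L := by
      have := hL'.2.trans hL.2.symm
      exact smul_right_injective _ (by norm_num : (1 / 2 : ℂ) ≠ 0) this
    have c (A B : Matrix (Fin n) (Fin n) ℂ) :
        (A * (B * ρ θ + ρ θ * B)).trace = (ρ θ * (A * B)).trace + (ρ θ * (B * A)).trace := by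
      rw [mul_add, trace_add, ← mul_assoc, trace_mul_comm (A * B), trace_mul_comm A (ρ θ * B),
        mul_assoc (ρ θ)]
    have h1 := congrArg (fun M => (L' * M).trace) e
    have h2 := congrArg (fun M => (L * M).trace) e
    simp only [c] at h1 h2
    linear_combination (1 / 2 : ℂ) * h1 + (1 / 2 : ℂ) * h2
  have h : ∃ L, IsSLD ρ θ L := ⟨L, hL⟩
  rw [qfi, dif_pos h, key _ h.choose_spec]

theorem exists_isSLD {n : ℕ} {ρ : ℝ → Matrix (Fin n) (Fin n) ℂ} {θ₀ : ℝ}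
    (h : IsOneParameterState ρ θ₀) : ∃ L, IsSLD ρ θ₀ L := by
  have hd : ∀ i j, HasDerivAt (fun t => ρ t i j) (matDeriv ρ θ₀ i j) θ₀ :=
    fun i j => (h.self_of_nhds.2 i j).hasDerivAt
  have hP : (ρ θ₀).PosSemidef := h.self_of_nhds.1.1
  have hH := hP.isHermitian
  have hD : (matDeriv ρ θ₀).IsHermitian := by
    ext i j
    have h1 : HasDerivAt (fun t => star (ρ t j i)) (star (matDeriv ρ θ₀ j i)) θ₀ :=
      (hd j i).star
    have h2 : (fun t => star (ρ t j i)) =ᶠ[𝓝 θ₀] fun t => ρ t i j :=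
      h.mono fun t ht => ht.1.1.isHermitian.apply i j
    exact (h1.congr_of_eventuallyEq h2.symm).unique (hd i j)
  have hker : ∀ v : Fin n → ℂ, ρ θ₀ *ᵥ v = 0 → star v ⬝ᵥ (matDeriv ρ θ₀ *ᵥ v) = 0 := by
    intro v hv
    have h1 : HasDerivAt (fun t => star v ⬝ᵥ (ρ t *ᵥ v)) (star v ⬝ᵥ (matDeriv ρ θ₀ *ᵥ v)) θ₀ := by
      simp only [dotProduct, mulVec]
      exact HasDerivAt.fun_sum fun i _ =>
        (HasDerivAt.fun_sum fun j _ => (hd i j).mul_const (v j)).const_mul _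
    have h2 : HasDerivAt (fun t => (star v ⬝ᵥ (ρ t *ᵥ v)).re)
        (star v ⬝ᵥ (matDeriv ρ θ₀ *ᵥ v)).re θ₀ :=
      Complex.reCLM.hasFDerivAt.comp_hasDerivAt θ₀ h1
    have h3 : IsLocalMin (fun t => (star v ⬝ᵥ (ρ t *ᵥ v)).re) θ₀ := by
      filter_upwards [h] with t ht
      simpa [hv] using (Complex.le_def.1 (ht.1.1.dotProduct_mulVec_nonneg v)).1
    apply Complex.ext
    · exact h3.hasDerivAt_eq_zero h2
    · exact hD.im_star_dotProduct_mulVec_self v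
  have hker2 : ∀ u v : Fin n → ℂ, ρ θ₀ *ᵥ u = 0 → ρ θ₀ *ᵥ v = 0 →
      star u ⬝ᵥ (matDeriv ρ θ₀ *ᵥ v) = 0 := by
    intro u v hu hv
    have a := hker u hu
    have b := hker v hv
    have c := hker (u + v) (by rw [mulVec_add, hu, hv, add_zero])
    have d := hker (u + Complex.I • v) (by rw [mulVec_add, mulVec_smul, hu, hv]; simp)
    simp only [star_add, star_smul, mulVec_add, mulVec_smul, add_dotProduct, dotProduct_add,
      smul_dotProduct, dotProduct_smul, smul_eq_mul, a, b] at c d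
    simp only [RCLike.star_def, Complex.conj_I] at d
    linear_combination (1 / 2 : ℂ) * c - (Complex.I / 2) * d +
      (1 / 2 : ℂ) * (star u ⬝ᵥ (matDeriv ρ θ₀ *ᵥ v) - star v ⬝ᵥ (matDeriv ρ θ₀ *ᵥ u)) *
        Complex.I_sq
  set U : Matrix (Fin n) (Fin n) ℂ := (hH.eigenvectorUnitary : Matrix (Fin n) (Fin n) ℂ) with hU
  have U1 : star U * U = 1 := Unitary.coe_star_mul_self _
  have U2 : U * star U = 1 := Unitary.coe_mul_star_self _
  set l := hH.eigenvalues with hl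
  set Λ : Matrix (Fin n) (Fin n) ℂ := diagonal fun i => (l i : ℂ) with hΛ
  have hρ : ρ θ₀ = U * Λ * star U := by
    have := hH.spectral_theorem
    simpa [Unitary.conjStarAlgAut_apply, hΛ, hU, hl, Function.comp_def] using this
  have hl0 : ∀ i, 0 ≤ l i := hP.eigenvalues_nonneg
  set B := star U * matDeriv ρ θ₀ * U with hB
  have hBH : B.IsHermitian := by
    have hD' : star (matDeriv ρ θ₀) = matDeriv ρ θ₀ := hD
    change star (star U * matDeriv ρ θ₀ * U) = star U * matDeriv ρ θ₀ * U
    rw [star_mul, star_mul, star_star, hD', mul_assoc]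
  have hUB : U * B * star U = matDeriv ρ θ₀ := by
    calc U * B * star U = (U * star U) * matDeriv ρ θ₀ * (U * star U) := by
          simp only [hB, mul_assoc]
      _ = matDeriv ρ θ₀ := by rw [U2, one_mul, mul_one]
  have hB0 : ∀ i j, l i + l j = 0 → B i j = 0 := by
    intro i j hij
    have hi : l i = 0 := by linarith [hl0 i, hl0 j]
    have hj : l j = 0 := by linarith [hl0 i, hl0 j]
    have hcol : ∀ k, l k = 0 → ρ θ₀ *ᵥ (U.col k) = 0 := by
      intro k hk
      have e : ρ θ₀ * U = U * Λ := by rw [hρ, mul_assoc, U1, mul_one]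
      ext a
      have := congrFun (congrFun e a) k
      rw [hΛ, Matrix.mul_diagonal, hk, Matrix.mul_apply] at this
      simpa [mulVec, dotProduct] using this
    have := hker2 _ _ (hcol i hi) (hcol j hj)
    rw [← this]
    simp only [hB, mul_assoc]
    simp [Matrix.mul_apply, dotProduct, mulVec, star_apply]
  set K : Matrix (Fin n) (Fin n) ℂ := Matrix.of fun i j => 2 * B i j / (l i + l j : ℂ) with hK
  have hKH : K.IsHermitian := by
    ext i j
    have := hBH.apply i j
    simp only [hK, conjTranspose_apply, of_apply, star_div₀, star_mul', this]
    simp [add_comm]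
  have hKB : (1 / 2 : ℂ) • (K * Λ + Λ * K) = B := by
    ext i j
    simp only [hΛ, Matrix.smul_apply, Matrix.add_apply, mul_diagonal, diagonal_mul, hK, of_apply, smul_eq_mul]
    by_cases hij : l i + l j = 0
    · rw [hB0 i j hij]; simp
    · have : (l i + l j : ℂ) ≠ 0 := by exact_mod_cast hij
      field_simp
      ring
  refine ⟨U * K * star U, ?_, ?_⟩
  · have hK' : star K = K := hKH
    change star (U * K * star U) = U * K * star U
    rw [star_mul, star_mul, star_star, hK', mul_assoc]
  · rw [← hUB, ← hKB, hρ]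
    have e1 : U * K * star U * (U * Λ * star U) = U * (K * Λ) * star U := by
      calc _ = U * K * (star U * U) * Λ * star U := by simp only [mul_assoc]
        _ = _ := by rw [U1, mul_one]; simp only [mul_assoc]
    have e2 : U * Λ * star U * (U * K * star U) = U * (Λ * K) * star U := by
      calc _ = U * Λ * (star U * U) * K * star U := by simp only [mul_assoc]
        _ = _ := by rw [U1, mul_one]; simp only [mul_assoc]
    rw [e1, e2, Matrix.mul_smul, Matrix.smul_mul, mul_add, add_mul]

/-- The quotients `F(N(σ_θ)) / F(σ_θ)` over all one-parameter qubit states `σ_θ` (around any true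
value of the parameter) with `F(σ_θ) ≠ 0`. -/
def qfiRatios
    (N : Matrix (Fin 2) (Fin 2) ℂ →ₗ[ℂ] Matrix (Fin 2) (Fin 2) ℂ) : Set ℝ :=
  {r | ∃ (σ : ℝ → Matrix (Fin 2) (Fin 2) ℂ) (θ : ℝ), IsOneParameterState σ θ ∧ qfi σ θ ≠ 0 ∧
    r = qfi (fun t => N (σ t)) θ / qfi σ θ}

/-- The contraction coefficient of `N` with respect to the quantum Fisher information. -/
def qfiContraction
    (N : Matrix (Fin 2) (Fin 2) ℂ →ₗ[ℂ] Matrix (Fin 2) (Fin 2) ℂ) : ℝ :=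
  sSup (qfiRatios N)

end

/-! In Pauli coordinates `N` acts by `(c, a) ↦ (c, c • t + T a)`, and positivity says that `x ↦ t +
T x` maps the unit ball to itself (`map_ofBloch`, `norm_blochVector_add_le`). A traceless `ofBloch 0
a` squares to `‖a‖²` times the identity, so its trace norm is `2‖a‖`; hence the trace-norm ratios
are `‖T a‖ / ‖a‖`, with maximum the top singular value `s` of `T`. As the maximum is attained,
strict contractivity gives `s < 1`.

For a state with Bloch vector `w`, the SLD equation forces the SLD to have coordinates `(-⟪b, w⟫,
b)`, and the QFI is `‖b‖² - ⟪b, w⟫²` (`exists_qfi_eq`). The core is `bures_contraction`: with `z =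
⟪b', t + T w⟫`, the vector `(z, b')` for the output is the image under the channel of some `(z, y)`
whose form `‖y‖² - z²` is at most the input QFI. This Lorentz form shrinks by the factor `s` when it
is nonnegative and stays nonpositive when it is nonpositive. -/

noncomputable section

/-! ### Singular values as extremal norm ratios. -/

section Singular

variable {E F : Type*} [NormedAddCommGroup E] [InnerProductSpace ℝ E] [FiniteDimensional ℝ E]
  [NormedAddCommGroup F] [InnerProductSpace ℝ F] [FiniteDimensional ℝ F]

/-- The largest singular value bounds the operator norm. -/
theorem LinearMap.norm_apply_le_singularValues_zero (T : E →ₗ[ℝ] F) (x : E) :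
    ‖T x‖ ≤ T.singularValues 0 * ‖x‖ := by
  have hS := T.isSymmetric_adjoint_comp_self
  set b := hS.eigenvectorBasis rfl with hb
  have h1 : ‖T x‖ ^ 2 = ∑ i : Fin (Module.finrank ℝ E), T.singularValues i ^ 2 * inner ℝ (b i) x ^ 2 := by
    rw [← real_inner_self_eq_norm_sq, ← LinearMap.adjoint_inner_right,
      ← b.sum_inner_mul_inner]
    refine Finset.sum_congr rfl fun i _ => ?_
    have h2 : inner ℝ (b i) (T.adjoint (T x)) = inner ℝ ((T.adjoint ∘ₗ T) (b i)) x := by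
      simp [LinearMap.adjoint_inner_left, LinearMap.adjoint_inner_right]
    rw [h2, hb, hS.apply_eigenvectorBasis rfl i, ← hb, T.sq_singularValues_fin rfl i,
      real_inner_comm]
    simp only [RCLike.ofReal_real_eq_id, id_eq, real_inner_smul_left]
    ring
  have h3 : ‖T x‖ ^ 2 ≤ (T.singularValues 0 * ‖x‖) ^ 2 := by
    rw [h1, mul_pow, ← b.sum_sq_norm_inner_right x, Finset.mul_sum]
    refine Finset.sum_le_sum fun i _ => ?_
    rw [Real.norm_eq_abs, sq_abs]
    gcongr
    · exact T.singularValues_nonneg _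
    · exact T.singularValues_antitone (Nat.zero_le _)
  exact le_of_sq_le_sq h3 (mul_nonneg (T.singularValues_nonneg _) (norm_nonneg _))

/-- Every singular value is attained as a ratio of norms. -/
theorem LinearMap.exists_norm_apply_eq_singularValues {𝕜 G H : Type*} [RCLike 𝕜]
    [NormedAddCommGroup G] [InnerProductSpace 𝕜 G] [FiniteDimensional 𝕜 G]
    [NormedAddCommGroup H] [InnerProductSpace 𝕜 H] [FiniteDimensional 𝕜 H]
    (T : G →ₗ[𝕜] H) {n : ℕ} (hn : n < Module.finrank 𝕜 G) :
    ∃ x, x ≠ 0 ∧ ‖T x‖ = T.singularValues n * ‖x‖ := by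
  obtain ⟨x, hx⟩ := (T.hasEigenvalue_adjoint_comp_self_sq_singularValues hn).exists_hasEigenvector
  refine ⟨x, hx.2, ?_⟩
  have h1 : T.adjoint (T x) = ((T.singularValues n ^ 2 : ℝ) : 𝕜) • x := by
    simpa using hx.apply_eq_smul
  have h2 : ((‖T x‖ ^ 2 : ℝ) : 𝕜) = ((T.singularValues n ^ 2 * ‖x‖ ^ 2 : ℝ) : 𝕜) := by
    have := inner_self_eq_norm_sq_to_K (𝕜 := 𝕜) (T x)
    rw [← LinearMap.adjoint_inner_right, h1, inner_smul_right, inner_self_eq_norm_sq_to_K] at this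
    push_cast at this ⊢
    exact this.symm
  have h3 : ‖T x‖ ^ 2 = (T.singularValues n * ‖x‖) ^ 2 := by
    rw [mul_pow]
    exact_mod_cast h2
  exact (sq_eq_sq₀ (norm_nonneg _)
    (mul_nonneg (T.singularValues_nonneg _) (norm_nonneg _))).1 h3

end Singular

/-! ### Affine self-maps of the unit ball and the Lorentz form `‖y‖² - z²`. -/

section Affine

variable {E : Type*} [NormedAddCommGroup E] [InnerProductSpace ℝ E]
  {T : E →ₗ[ℝ] E} {t : E} {s : ℝ}

/-- Homogenizing the ball condition: for `z ≠ 0`, rescale by `z⁻¹` to land in the unit ball. The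
sign of `z` is irrelevant, so both halves of the light cone are preserved. -/
theorem norm_map_add_smul_le (hball : ∀ x, ‖x‖ ≤ 1 → ‖t + T x‖ ≤ 1) {y : E} {z : ℝ}
    (h : ‖y‖ ≤ |z|) : ‖T y + z • t‖ ≤ |z| := by
  rcases eq_or_ne z 0 with rfl | hz
  · have : y = 0 := by simpa using h
    simp [this]
  · have hz' : 0 < |z| := abs_pos.2 hz
    have h1 : ‖z⁻¹ • y‖ ≤ 1 := by
      rw [norm_smul, norm_inv, Real.norm_eq_abs, inv_mul_le_iff₀ hz']
      simpa using h
    have h2 : T y + z • t = z • (t + T (z⁻¹ • y)) := by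
      rw [map_smul, smul_add, smul_inv_smul₀ hz, add_comm]
    rw [h2, norm_smul, Real.norm_eq_abs]
    exact mul_le_of_le_one_right hz'.le (hball _ h1)

/-- With `e = y / ‖y‖` and `r = ‖y‖`, split `T y + z • t = z • (t + T e) + (r - z) • T e`. The ball
condition gives `‖t + T e‖ ≤ 1`, Cauchy–Schwarz then gives `⟪t + T e, T e⟫ ≤ s`, and `‖T e‖² ≤ s² ≤
s`. The last two terms of the expanded square carry total weight `2z(r - z) + (r - z)² = r² - z²`.
-/
theorem sq_norm_map_add_smul_sub_sq_le_of_nonneg (hs1 : s ≤ 1) (hT : ∀ x, ‖T x‖ ≤ s * ‖x‖)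
    (hball : ∀ x, ‖x‖ ≤ 1 → ‖t + T x‖ ≤ 1) {y : E} {z : ℝ} (hz : 0 ≤ z) (h : z ≤ ‖y‖) :
    ‖T y + z • t‖ ^ 2 - z ^ 2 ≤ s * (‖y‖ ^ 2 - z ^ 2) := by
  rcases eq_or_ne y 0 with rfl | hy
  · have : z = 0 := le_antisymm (by simpa using h) hz
    simp [this]
  set r := ‖y‖ with hr
  have hr0 : 0 < r := norm_pos_iff.2 hy
  set e := r⁻¹ • y with he
  have he1 : ‖e‖ = 1 := by
    rw [he, norm_smul, norm_inv, Real.norm_eq_abs, abs_of_pos hr0, ← hr]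
    exact inv_mul_cancel₀ hr0.ne'
  have hye : y = r • e := by rw [he, smul_inv_smul₀ hr0.ne']
  have hk : ‖T e‖ ≤ s := by simpa [he1] using hT e
  have hk0 := norm_nonneg (T e)
  have hb : ‖t + T e‖ ≤ 1 := hball e he1.le
  have hb2 : ‖t‖ ^ 2 + 2 * inner ℝ t (T e) + ‖T e‖ ^ 2 ≤ 1 := by
    rw [← norm_add_sq_real]
    nlinarith [norm_nonneg (t + T e)]
  have hτ : inner ℝ t (T e) + ‖T e‖ ^ 2 ≤ s := by
    have := real_inner_le_norm (t + T e) (T e)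
    rw [inner_add_left, real_inner_self_eq_norm_sq] at this
    nlinarith
  have hk2 : ‖T e‖ ^ 2 ≤ s := by nlinarith
  have hexp : ‖T y + z • t‖ ^ 2 =
      r ^ 2 * ‖T e‖ ^ 2 + 2 * (r * z) * inner ℝ t (T e) + z ^ 2 * ‖t‖ ^ 2 := by
    rw [hye, map_smul, norm_add_sq_real, norm_smul, norm_smul, real_inner_smul_left,
      real_inner_smul_right, real_inner_comm, mul_pow, mul_pow, Real.norm_eq_abs, Real.norm_eq_abs,
      sq_abs, sq_abs]
    ring
  rw [hexp]
  have h1 := mul_le_mul_of_nonneg_left hb2 (sq_nonneg z)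
  have hrz : 0 ≤ r - z := sub_nonneg.2 h
  have h2 := mul_le_mul_of_nonneg_left hτ (mul_nonneg hrz hz)
  have h3 := mul_le_mul_of_nonneg_left hk2 (mul_nonneg hrz hrz)
  nlinarith

theorem sq_norm_map_add_smul_sub_sq_le (hs1 : s ≤ 1) (hT : ∀ x, ‖T x‖ ≤ s * ‖x‖)
    (hball : ∀ x, ‖x‖ ≤ 1 → ‖t + T x‖ ≤ 1) {y : E} {z : ℝ} (h : |z| ≤ ‖y‖) :
    ‖T y + z • t‖ ^ 2 - z ^ 2 ≤ s * (‖y‖ ^ 2 - z ^ 2) := by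
  rcases le_total 0 z with hz | hz
  · exact sq_norm_map_add_smul_sub_sq_le_of_nonneg hs1 hT hball hz (by rwa [abs_of_nonneg hz] at h)
  · have := sq_norm_map_add_smul_sub_sq_le_of_nonneg (y := -y) hs1 hT hball (neg_nonneg.2 hz)
      (by rwa [abs_of_nonpos hz, ← norm_neg y] at h)
    rwa [map_neg, neg_smul, ← neg_add, norm_neg, norm_neg, neg_sq] at this

/-- Contraction of the Bures metric of the unit ball under affine self-maps of the ball: if
`b - ⟪b, w⟫ w` is the tangent vector at `w` and `b' - ⟪b', u⟫ u` its image at `u = t + T w`, then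
the squared lengths `‖b‖² - ⟪b, w⟫²` decrease at least by the factor `s`. -/
theorem bures_contraction (hs0 : 0 ≤ s) (hs1 : s ≤ 1) (hT : ∀ x, ‖T x‖ ≤ s * ‖x‖)
    (hball : ∀ x, ‖x‖ ≤ 1 → ‖t + T x‖ ≤ 1) {w b b' : E} (hw : ‖w‖ ≤ 1)
    (himage : T (b - inner ℝ b w • w) = b' - inner ℝ b' (t + T w) • (t + T w)) :
    ‖b'‖ ^ 2 - inner ℝ b' (t + T w) ^ 2 ≤ s * (‖b‖ ^ 2 - inner ℝ b w ^ 2) := by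
  set c := inner ℝ b w with hc
  set z := inner ℝ b' (t + T w) with hz
  -- The difference of the two sides is `(z - c)² (1 - ‖w‖²)`, so only `‖w‖ ≤ 1` is needed.
  have hF : ‖b + (z - c) • w‖ ^ 2 - z ^ 2 ≤ ‖b‖ ^ 2 - c ^ 2 := by
    rw [norm_add_sq_real, real_inner_smul_right, ← hc, norm_smul, mul_pow, Real.norm_eq_abs, sq_abs]
    have : ‖w‖ ^ 2 ≤ 1 := by nlinarith [norm_nonneg w]
    nlinarith [mul_le_mul_of_nonneg_left this (sq_nonneg (z - c))]
  have hF0 : 0 ≤ ‖b‖ ^ 2 - c ^ 2 := by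
    have h1 := abs_real_inner_le_norm b w
    have h2 : |c| ≤ ‖b‖ := h1.trans (mul_le_of_le_one_right (norm_nonneg _) hw)
    exact sub_nonneg.2 (sq_le_sq.2 (by rwa [abs_of_nonneg (norm_nonneg b)]))
  -- Shifting by `(z - c) • w` gives the preimage the same scalar coordinate `z` as the output: `T
  -- w` and `t` recombine into `t + T w`, cancelling the projection term of `himage`.
  have hy : T (b + (z - c) • w) + z • t = b' := by
    have h1 : b + (z - c) • w = (b - c • w) + z • w := by module
    rw [h1, map_add, himage, map_smul]
    module
  -- Outside the cone the form contracts by `s`; inside it the output form is nonpositive.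
  rcases le_total |z| ‖b + (z - c) • w‖ with h | h
  · have := sq_norm_map_add_smul_sub_sq_le hs1 hT hball h
    rw [hy] at this
    exact this.trans (mul_le_mul_of_nonneg_left hF hs0)
  · have := norm_map_add_smul_le hball h
    rw [hy] at this
    have h2 : ‖b'‖ ^ 2 ≤ z ^ 2 := sq_le_sq.2 (by rwa [abs_of_nonneg (norm_nonneg b')])
    linarith [mul_nonneg hs0 hF0]

end Affine

/-! ### Pauli coordinates of qubit operators. -/

/-- The Hermitian matrix `c + a₀ X + a₁ Y + a₂ Z`. -/
def ofBloch (c : ℝ) (a : EuclideanSpace ℝ (Fin 3)) : Matrix (Fin 2) (Fin 2) ℂ :=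
  !![(c + a 2 : ℂ), a 0 - Complex.I * a 1; a 0 + Complex.I * a 1, c - a 2]

/-- The Pauli coordinates of a matrix. -/
def blochVector (A : Matrix (Fin 2) (Fin 2) ℂ) : EuclideanSpace ℝ (Fin 3) :=
  WithLp.toLp 2 fun i => ((pauli i * A).trace / 2).re

@[simp]
theorem blochVector_apply (A : Matrix (Fin 2) (Fin 2) ℂ) (i : Fin 3) :
    blochVector A i = ((pauli i * A).trace / 2).re := rfl

theorem EuclideanSpace.real_inner_fin_three (a b : EuclideanSpace ℝ (Fin 3)) :
    inner ℝ a b = a 0 * b 0 + a 1 * b 1 + a 2 * b 2 := by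
  simp [PiLp.inner_apply, Fin.sum_univ_three, mul_comm]

theorem EuclideanSpace.norm_sq_fin_three (a : EuclideanSpace ℝ (Fin 3)) :
    ‖a‖ ^ 2 = a 0 ^ 2 + a 1 ^ 2 + a 2 ^ 2 := by
  simp [EuclideanSpace.norm_sq_eq, Fin.sum_univ_three]

theorem ofBloch_isHermitian (c : ℝ) (a : EuclideanSpace ℝ (Fin 3)) : (ofBloch c a).IsHermitian := by
  ext i j
  fin_cases i <;> fin_cases j <;> simp [ofBloch, sub_eq_add_neg]

theorem trace_ofBloch (c : ℝ) (a : EuclideanSpace ℝ (Fin 3)) :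
    (ofBloch c a).trace = ((2 * c : ℝ) : ℂ) := by
  simp [ofBloch, trace_fin_two]
  ring

theorem ofBloch_add (c d : ℝ) (a b : EuclideanSpace ℝ (Fin 3)) :
    ofBloch (c + d) (a + b) = ofBloch c a + ofBloch d b := by
  ext i j
  fin_cases i <;> fin_cases j <;> simp [ofBloch] <;> ring

theorem ofBloch_smul (r c : ℝ) (a : EuclideanSpace ℝ (Fin 3)) :
    ofBloch (r * c) (r • a) = (r : ℂ) • ofBloch c a := by
  ext i j
  fin_cases i <;> fin_cases j <;> simp [ofBloch] <;> ring

theorem ofBloch_blochVector {A : Matrix (Fin 2) (Fin 2) ℂ} (hA : A.IsHermitian) :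
    ofBloch (A.trace.re / 2) (blochVector A) = A := by
  have h00 := congrArg Complex.im (hA.apply 0 0)
  have h11 := congrArg Complex.im (hA.apply 1 1)
  have h01 := congrArg Complex.re (hA.apply 0 1)
  have h01' := congrArg Complex.im (hA.apply 0 1)
  simp at h00 h11 h01 h01'
  ext i j
  fin_cases i <;> fin_cases j <;> apply Complex.ext <;>
    simp [ofBloch, pauli, trace_fin_two, vecMul, vecHead, vecTail, ← Complex.ofReal_ofNat] <;>
    linarith

theorem blochVector_ofBloch (c : ℝ) (a : EuclideanSpace ℝ (Fin 3)) :
    blochVector (ofBloch c a) = a := by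
  ext i
  fin_cases i <;> simp [ofBloch, pauli, trace_fin_two, ← Complex.ofReal_ofNat]
  ring

theorem ofBloch_injective {c d : ℝ} {a b : EuclideanSpace ℝ (Fin 3)}
    (h : ofBloch c a = ofBloch d b) : c = d ∧ a = b := by
  refine ⟨?_, by rw [← blochVector_ofBloch c a, h, blochVector_ofBloch]⟩
  have := congrArg Matrix.trace h
  rw [trace_ofBloch, trace_ofBloch, Complex.ofReal_inj] at this
  linarith

/-- The Jordan product has no cross-product term, so the SLD equation becomes one scalar and one
vector equation. -/
theorem ofBloch_anticomm (c d : ℝ) (a b : EuclideanSpace ℝ (Fin 3)) :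
    (1 / 2 : ℂ) • (ofBloch c a * ofBloch d b + ofBloch d b * ofBloch c a) =
      ofBloch (c * d + inner ℝ a b) (c • b + d • a) := by
  rw [EuclideanSpace.real_inner_fin_three]
  ext i j
  fin_cases i <;> fin_cases j <;>
    simp [ofBloch] <;> ring_nf <;> simp [Complex.I_sq]

theorem ofBloch_mul_self (c : ℝ) (a : EuclideanSpace ℝ (Fin 3)) :
    ofBloch c a * ofBloch c a = ofBloch (c ^ 2 + ‖a‖ ^ 2) ((2 * c) • a) := by
  have h := ofBloch_anticomm c c a a
  rw [← two_smul ℂ, smul_smul, real_inner_self_eq_norm_sq, ← two_smul ℝ (c • a), smul_smul] at h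
  simpa [sq] using h

theorem trace_ofBloch_mul (c d : ℝ) (a b : EuclideanSpace ℝ (Fin 3)) :
    (ofBloch c a * ofBloch d b).trace = ((2 * (c * d + inner ℝ a b) : ℝ) : ℂ) := by
  rw [← trace_ofBloch _ (c • b + d • a), ← ofBloch_anticomm, trace_smul, trace_add,
    trace_mul_comm (ofBloch d b), smul_eq_mul]
  ring

theorem det_ofBloch (c : ℝ) (a : EuclideanSpace ℝ (Fin 3)) :
    (ofBloch c a).det = ((c ^ 2 - ‖a‖ ^ 2 : ℝ) : ℂ) := by
  rw [EuclideanSpace.norm_sq_fin_three]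
  simp [ofBloch, det_fin_two]
  ring_nf
  simp [Complex.I_sq]
  ring

theorem ofBloch_posSemidef {c : ℝ} {a : EuclideanSpace ℝ (Fin 3)} :
    (ofBloch c a).PosSemidef ↔ ‖a‖ ≤ c := by
  constructor
  · intro h
    have h1 := h.det_nonneg
    have h2 := h.trace_nonneg
    rw [det_ofBloch, Complex.zero_le_real] at h1
    rw [trace_ofBloch, Complex.zero_le_real] at h2
    exact le_of_sq_le_sq (by linarith) (by linarith)
  · intro h
    have hsq : ∀ r : ℝ, ∀ b : EuclideanSpace ℝ (Fin 3),
        (ofBloch (r ^ 2 + ‖b‖ ^ 2) ((2 * r) • b)).PosSemidef := by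
      intro r b
      rw [← ofBloch_mul_self]
      nth_rewrite 1 [← (ofBloch_isHermitian r b).eq]
      exact posSemidef_conjTranspose_mul_self _
    rcases (norm_nonneg a).eq_or_lt with h0 | h0
    · have := hsq (√c) 0
      rw [Real.sq_sqrt ((norm_nonneg a).trans h)] at this
      simpa [norm_eq_zero.1 h0.symm] using this
    -- The square root of the rank-one part `ofBloch ‖a‖ a`; adding `c - ‖a‖` times the identity
    -- yields the whole matrix.
    · have h1 := hsq (√(‖a‖ / 2)) ((2 * √(‖a‖ / 2))⁻¹ • a)
      have h2 := hsq (√(c - ‖a‖)) 0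
      have h3 : √(‖a‖ / 2) ≠ 0 := (Real.sqrt_pos.2 (by linarith)).ne'
      have h4 : √(‖a‖ / 2) ^ 2 = ‖a‖ / 2 := Real.sq_sqrt (by linarith)
      rw [smul_inv_smul₀ (by simpa using h3), norm_smul, mul_pow, Real.norm_eq_abs, sq_abs, inv_pow,
        mul_pow, h4] at h1
      have h5 := h1.add h2
      rw [← ofBloch_add, Real.sq_sqrt (by linarith)] at h5
      convert h5 using 2
      · field_simp
        simp
        ring
      · simp

/-- The matrix is Hermitian with square `‖a‖²`, so it scales every norm by `‖a‖` and both singular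
values equal `‖a‖`. -/
theorem traceNorm_ofBloch_zero (a : EuclideanSpace ℝ (Fin 3)) :
    traceNorm (ofBloch 0 a) = 2 * ‖a‖ := by
  have hnorm : ∀ x, ‖Matrix.toEuclideanLin (ofBloch 0 a) x‖ = ‖a‖ * ‖x‖ := by
    intro x
    have h1 : Matrix.toEuclideanLin (ofBloch 0 a) (Matrix.toEuclideanLin (ofBloch 0 a) x) =
        ((‖a‖ ^ 2 : ℝ) : ℂ) • x := by
      have h2 : ofBloch 0 a * ofBloch 0 a = ((‖a‖ ^ 2 : ℝ) : ℂ) • 1 := by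
        rw [ofBloch_mul_self]
        ext i j
        fin_cases i <;> fin_cases j <;> simp [ofBloch]
      rw [Matrix.toLpLin_apply, Matrix.toLpLin_apply, Matrix.mulVec_mulVec, h2,
        Matrix.smul_mulVec, Matrix.one_mulVec]
      rfl
    have h3 : ((‖Matrix.toEuclideanLin (ofBloch 0 a) x‖ ^ 2 : ℝ) : ℂ) =
        ((‖a‖ ^ 2 * ‖x‖ ^ 2 : ℝ) : ℂ) := by
      have h4 := inner_self_eq_norm_sq_to_K (𝕜 := ℂ) (Matrix.toEuclideanLin (ofBloch 0 a) x)
      have h5 := Matrix.toEuclideanLin_conjTranspose_eq_adjoint (ofBloch 0 a)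
      rw [(ofBloch_isHermitian 0 a).eq] at h5
      rw [← LinearMap.adjoint_inner_right, ← h5, h1, inner_smul_right,
        inner_self_eq_norm_sq_to_K] at h4
      push_cast at h4 ⊢
      exact h4.symm
    refine (sq_eq_sq₀ (norm_nonneg _) (by positivity)).1 ?_
    rw [mul_pow]
    exact_mod_cast h3
  have hσ : ∀ i : Fin 2, (Matrix.toEuclideanLin (ofBloch 0 a)).singularValues i = ‖a‖ := by
    intro i
    obtain ⟨x, hx, h⟩ := (Matrix.toEuclideanLin (ofBloch 0 a)).exists_norm_apply_eq_singularValues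
      (n := i) (by simpa using i.is_le)
    rw [hnorm] at h
    exact (mul_right_cancel₀ (norm_ne_zero_iff.2 hx) h).symm
  simp only [traceNorm, hσ]
  simp

theorem ofBloch_eq_sum (c : ℝ) (a : EuclideanSpace ℝ (Fin 3)) :
    ofBloch c a = (c : ℂ) • 1 + ∑ j, (a j : ℂ) • pauli j := by
  ext i j
  fin_cases i <;> fin_cases j <;> simp [ofBloch, pauli, Fin.sum_univ_three] <;> ring

/-! ### Quantum Fisher information in Bloch coordinates. -/

theorem IsOneParameterState.trace_matDeriv {n : ℕ} {σ : ℝ → Matrix (Fin n) (Fin n) ℂ} {θ : ℝ}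
    (h : IsOneParameterState σ θ) : (matDeriv σ θ).trace = 0 := by
  have h1 : HasDerivAt (fun t => (σ t).trace) (matDeriv σ θ).trace θ :=
    HasDerivAt.fun_sum fun i _ => (h.self_of_nhds.2 i i).hasDerivAt
  have h2 : (fun t => (σ t).trace) =ᶠ[𝓝 θ] fun _ => 1 := h.mono fun t ht => ht.1.2
  exact (h1.congr_of_eventuallyEq h2.symm).unique (hasDerivAt_const θ 1)

/-- The quantum Fisher information of a qubit state with Bloch vector `w`, in terms of the Bloch
vector `b` of a symmetric logarithmic derivative. -/
theorem exists_qfi_eq {σ : ℝ → Matrix (Fin 2) (Fin 2) ℂ} {θ : ℝ}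
    (h : IsOneParameterState σ θ) {w : EuclideanSpace ℝ (Fin 3)}
    (hw : σ θ = ofBloch (1 / 2) ((1 / 2 : ℝ) • w)) :
    ∃ b : EuclideanSpace ℝ (Fin 3),
      matDeriv σ θ = ofBloch 0 ((1 / 2 : ℝ) • (b - inner ℝ b w • w)) ∧
        qfi σ θ = ‖b‖ ^ 2 - inner ℝ b w ^ 2 := by
  obtain ⟨L, hL⟩ := exists_isSLD h
  have hLb := ofBloch_blochVector hL.1
  set a := L.trace.re / 2
  set b := blochVector L
  have hD := hL.2
  rw [← hLb, hw, ofBloch_anticomm] at hD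
  -- Vanishing trace of the derivative fixes the scalar part of the SLD.
  have ha : a = -inner ℝ b w := by
    have h0 := h.trace_matDeriv
    rw [← hD, trace_ofBloch, Complex.ofReal_eq_zero, real_inner_smul_right] at h0
    linarith
  refine ⟨b, ?_, ?_⟩
  · rw [← hD, real_inner_smul_right, ha]
    congr 1
    · ring
    · module
  · rw [qfi_eq hL, ← hLb, hw, ofBloch_mul_self, trace_ofBloch_mul, Complex.ofReal_re,
      real_inner_smul_left, real_inner_smul_right, real_inner_comm, ha]
    ring

theorem IsDensity.exists_eq_ofBloch {ρ : Matrix (Fin 2) (Fin 2) ℂ} (h : IsDensity ρ) :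
    ∃ w : EuclideanSpace ℝ (Fin 3), ‖w‖ ≤ 1 ∧ ρ = ofBloch (1 / 2) ((1 / 2 : ℝ) • w) := by
  have h1 := ofBloch_blochVector h.1.isHermitian
  rw [h.2, Complex.one_re] at h1
  have h2 := ofBloch_posSemidef.1 (h1.symm ▸ h.1)
  refine ⟨(2 : ℝ) • blochVector ρ, ?_, ?_⟩
  · rw [norm_smul, Real.norm_ofNat]
    linarith
  · rw [smul_smul]
    norm_num [h1]

theorem hasDerivAt_map_apply (N : Matrix (Fin 2) (Fin 2) ℂ →ₗ[ℂ] Matrix (Fin 2) (Fin 2) ℂ)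
    {σ : ℝ → Matrix (Fin 2) (Fin 2) ℂ} {θ : ℝ}
    (h : ∀ i j, DifferentiableAt ℝ (fun t => σ t i j) θ) (i j : Fin 2) :
    HasDerivAt (fun t => N (σ t) i j) (N (matDeriv σ θ) i j) θ := by
  have hsum : ∀ M : Matrix (Fin 2) (Fin 2) ℂ,
      N M i j = ∑ k, ∑ l, M k l * N (Matrix.single k l 1) i j := by
    intro M
    conv_lhs => rw [matrix_eq_sum_single M]
    simp only [map_sum, Matrix.sum_apply]
    refine Finset.sum_congr rfl fun k _ => Finset.sum_congr rfl fun l _ => ?_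
    have : Matrix.single k l (M k l) = M k l • Matrix.single k l (1 : ℂ) := by
      rw [Matrix.smul_single, smul_eq_mul, mul_one]
    rw [this, map_smul, Matrix.smul_apply, smul_eq_mul]
  rw [funext fun t => hsum (σ t), hsum (matDeriv σ θ)]
  exact HasDerivAt.fun_sum fun k _ => HasDerivAt.fun_sum fun l _ =>
    (h k l).hasDerivAt.mul_const _

theorem matDeriv_map (N : Matrix (Fin 2) (Fin 2) ℂ →ₗ[ℂ] Matrix (Fin 2) (Fin 2) ℂ)
    {σ : ℝ → Matrix (Fin 2) (Fin 2) ℂ} {θ : ℝ}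
    (h : ∀ i j, DifferentiableAt ℝ (fun t => σ t i j) θ) :
    matDeriv (fun t => N (σ t)) θ = N (matDeriv σ θ) := by
  ext i j
  exact (hasDerivAt_map_apply N h i j).deriv

/-! ### Qubit channels as affine maps of the Bloch ball. -/

namespace IsQubitChannel

variable {N : Matrix (Fin 2) (Fin 2) ℂ →ₗ[ℂ] Matrix (Fin 2) (Fin 2) ℂ}

theorem posSemidef_map (hN : IsQubitChannel N) {M : Matrix (Fin 2) (Fin 2) ℂ}
    (hM : M.PosSemidef) : (N M).PosSemidef :=
  (hN.completelyPositive 1 (M.submatrix Prod.snd Prod.snd) (hM.submatrix _)).submatrix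
    fun a => ((0 : Fin 1), a)

theorem isHermitian_map_ofBloch (hN : IsQubitChannel N) (c : ℝ) (a : EuclideanSpace ℝ (Fin 3)) :
    (N (ofBloch c a)).IsHermitian := by
  -- A Hermitian matrix is a positive one plus a real multiple of the identity, so positivity of `N`
  -- implies Hermiticity preservation.
  have h1 : ofBloch c a = ofBloch ‖a‖ a + ((c - ‖a‖ : ℝ) : ℂ) • ofBloch 1 0 := by
    rw [← ofBloch_smul, ← ofBloch_add]
    simp
  have h2 := (hN.posSemidef_map (ofBloch_posSemidef.2 (le_refl ‖a‖))).isHermitian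
  have h3 := (hN.posSemidef_map
    (ofBloch_posSemidef.2 (by simp : ‖(0 : EuclideanSpace ℝ (Fin 3))‖ ≤ 1))).isHermitian
  rw [h1, map_add, map_smul]
  refine h2.add ?_
  rw [Matrix.IsHermitian, conjTranspose_smul, h3.eq]
  simp

/-- A qubit channel acts on Pauli coordinates as an affine map with linear part the Pauli transfer
matrix. -/
theorem map_ofBloch (hN : IsQubitChannel N) (c : ℝ) (a : EuclideanSpace ℝ (Fin 3)) :
    N (ofBloch c a) =
      ofBloch c (c • blochVector (N 1) + Matrix.toEuclideanLin (pauliTransfer N) a) := by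
  have h1 := ofBloch_blochVector (hN.isHermitian_map_ofBloch c a)
  rw [hN.tracePreserving, trace_ofBloch, Complex.ofReal_re, mul_div_cancel_left₀ c two_ne_zero]
    at h1
  rw [← h1]
  congr 1
  ext i
  simp [ofBloch_eq_sum, Matrix.mul_add, Matrix.mul_sum, Matrix.toLpLin_apply, pauliTransfer, mulVec,
    dotProduct, ← Complex.ofReal_ofNat, trace_add, trace_sum, add_div,
    mul_div_assoc, mul_comm, Finset.sum_div]

theorem norm_blochVector_add_le (hN : IsQubitChannel N) (x : EuclideanSpace ℝ (Fin 3))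
    (hx : ‖x‖ ≤ 1) :
    ‖blochVector (N 1) + Matrix.toEuclideanLin (pauliTransfer N) x‖ ≤ 1 := by
  have := hN.posSemidef_map (ofBloch_posSemidef.2 hx)
  rw [hN.map_ofBloch, one_smul] at this
  exact ofBloch_posSemidef.1 this

theorem isOneParameterState_map (hN : IsQubitChannel N) {σ : ℝ → Matrix (Fin 2) (Fin 2) ℂ}
    {θ : ℝ} (h : IsOneParameterState σ θ) : IsOneParameterState (fun t => N (σ t)) θ := by
  filter_upwards [h] with t ht
  refine ⟨⟨hN.posSemidef_map ht.1.1, by rw [hN.tracePreserving, ht.1.2]⟩, fun i j => ?_⟩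
  exact (hasDerivAt_map_apply N ht.2 i j).differentiableAt

theorem qfi_map_le (hN : IsQubitChannel N) {s : ℝ} (hs0 : 0 ≤ s) (hs1 : s ≤ 1)
    (hT : ∀ x, ‖Matrix.toEuclideanLin (pauliTransfer N) x‖ ≤ s * ‖x‖)
    {σ : ℝ → Matrix (Fin 2) (Fin 2) ℂ} {θ : ℝ} (h : IsOneParameterState σ θ) :
    qfi (fun t => N (σ t)) θ ≤ s * qfi σ θ := by
  obtain ⟨w, hw1, hw⟩ := h.self_of_nhds.1.exists_eq_ofBloch
  obtain ⟨b, hD, hF⟩ := exists_qfi_eq h hw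
  have hu : N (σ θ) = ofBloch (1 / 2) ((1 / 2 : ℝ) •
      (blochVector (N 1) + Matrix.toEuclideanLin (pauliTransfer N) w)) := by
    rw [hw, hN.map_ofBloch, map_smul, smul_add]
  obtain ⟨b', hD', hF'⟩ := exists_qfi_eq (hN.isOneParameterState_map h) hu
  rw [matDeriv_map N h.self_of_nhds.2, hD, hN.map_ofBloch, zero_smul, zero_add, map_smul] at hD'
  have himage := smul_right_injective _ (by norm_num : (1 / 2 : ℝ) ≠ 0) (ofBloch_injective hD').2
  rw [hF, hF']
  exact bures_contraction hs0 hs1 hT hN.norm_blochVector_add_le hw1 himage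

theorem mem_traceNormRatios (hN : IsQubitChannel N) {r : ℝ} :
    r ∈ traceNormRatios N ↔ ∃ a : EuclideanSpace ℝ (Fin 3), a ≠ 0 ∧
      r = ‖Matrix.toEuclideanLin (pauliTransfer N) a‖ / ‖a‖ := by
  have key : ∀ a : EuclideanSpace ℝ (Fin 3), traceNorm (N (ofBloch 0 a)) / traceNorm (ofBloch 0 a) =
      ‖Matrix.toEuclideanLin (pauliTransfer N) a‖ / ‖a‖ := by
    intro a
    rw [hN.map_ofBloch, zero_smul, zero_add, traceNorm_ofBloch_zero, traceNorm_ofBloch_zero,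
      mul_div_mul_left _ _ two_ne_zero]
  have h0 : ofBloch 0 0 = 0 := by simp [ofBloch_eq_sum]
  constructor
  · rintro ⟨A, hA, htr, hA0, rfl⟩
    have h := ofBloch_blochVector hA
    rw [htr, Complex.zero_re, zero_div] at h
    refine ⟨blochVector A, fun h' => hA0 ?_, by rw [← key, h]⟩
    rw [← h, h', h0]
  · rintro ⟨a, ha, rfl⟩
    refine ⟨ofBloch 0 a, ofBloch_isHermitian 0 a, by simp [trace_ofBloch], fun h => ha ?_,
      (key a).symm⟩
    exact (ofBloch_injective (h.trans h0.symm)).2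

theorem isGreatest_traceNormRatios (hN : IsQubitChannel N) :
    IsGreatest (traceNormRatios N)
      ((Matrix.toEuclideanLin (pauliTransfer N)).singularValues 0) := by
  constructor
  · obtain ⟨a, ha, h⟩ := (Matrix.toEuclideanLin
      (pauliTransfer N)).exists_norm_apply_eq_singularValues (n := 0) (by simp)
    exact hN.mem_traceNormRatios.2
      ⟨a, ha, by rw [h, mul_div_cancel_right₀ _ (norm_ne_zero_iff.2 ha)]⟩
  · intro r hr
    obtain ⟨a, ha, rfl⟩ := hN.mem_traceNormRatios.1 hr
    rw [div_le_iff₀ (norm_pos_iff.2 ha)]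
    exact LinearMap.norm_apply_le_singularValues_zero _ a

end IsQubitChannel

/-! ### A state with nonzero QFI, and the conclusion. -/

theorem qfiRatios_nonempty (N : Matrix (Fin 2) (Fin 2) ℂ →ₗ[ℂ] Matrix (Fin 2) (Fin 2) ℂ) :
    (qfiRatios N).Nonempty := by
  -- A straight line through the maximally mixed state; length `1 / 2` keeps `t • e` in the state
  -- space for `|t| < 1`.
  set e : EuclideanSpace ℝ (Fin 3) := EuclideanSpace.single 2 (1 / 2) with he
  have hen : ‖e‖ = 1 / 2 := by simp [he]
  set σ : ℝ → Matrix (Fin 2) (Fin 2) ℂ := fun t => ofBloch (1 / 2) (t • e) with hσ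
  have hd : ∀ t i j, HasDerivAt (fun t => σ t i j) (ofBloch 0 e i j) t := by
    intro t i j
    have h1 : ∀ t, σ t i j = ofBloch (1 / 2) 0 i j + (t : ℂ) * ofBloch 0 e i j := by
      intro t
      have : ofBloch (1 / 2) (t • e) = ofBloch (1 / 2) 0 + (t : ℂ) • ofBloch 0 e := by
        rw [← ofBloch_smul, ← ofBloch_add]
        simp
      simp only [hσ, this, Matrix.add_apply, Matrix.smul_apply, smul_eq_mul]
    simp only [h1]
    simpa using (((hasDerivAt_id t).ofReal_comp.mul_const (ofBloch 0 e i j)).const_add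
      (ofBloch (1 / 2) 0 i j))
  have hstate : IsOneParameterState σ 0 := by
    filter_upwards [Metric.ball_mem_nhds (0 : ℝ) one_pos] with t ht
    refine ⟨⟨ofBloch_posSemidef.2 ?_, by simp [hσ, trace_ofBloch]⟩,
      fun i j => (hd t i j).differentiableAt⟩
    rw [norm_smul, hen]
    have : ‖t‖ < 1 := by simpa using ht
    linarith
  refine ⟨_, σ, 0, hstate, ?_, rfl⟩
  obtain ⟨b, hD, hF⟩ := exists_qfi_eq hstate (w := 0) (by simp [hσ])
  have hD2 : matDeriv σ 0 = ofBloch 0 e := by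
    ext i j
    exact (hd 0 i j).deriv
  rw [hD2] at hD
  have hb := (ofBloch_injective hD).2
  rw [hF]
  intro h0
  have hb0 : b = 0 := by simpa using h0
  rw [hb0] at hb
  rw [hb] at hen
  norm_num at hen

theorem propositionS3 (N : Matrix (Fin 2) (Fin 2) ℂ →ₗ[ℂ] Matrix (Fin 2) (Fin 2) ℂ)
    (hN : IsQubitChannel N) (hc : IsStrictlyContractive N) :
    ((qfiRatios N).Nonempty ∧ BddAbove (qfiRatios N)) ∧
    IsGreatest (traceNormRatios N) (traceContraction N) ∧
    qfiContraction N ≤ traceContraction N ∧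
    traceContraction N = (Matrix.toEuclideanLin (pauliTransfer N)).singularValues 0 ∧
    traceContraction N < 1 ∧
    qfiContraction N < 1 := by
  have hg := hN.isGreatest_traceNormRatios
  have hs : traceContraction N = (Matrix.toEuclideanLin (pauliTransfer N)).singularValues 0 :=
    hg.csSup_eq
  rw [← hs] at hg
  have hlt : traceContraction N < 1 := by
    -- Attainment makes the pointwise strict inequality survive the supremum.
    obtain ⟨A, hA, htr, hA0, h⟩ := hg.1
    have hAN := hc A hA htr hA0
    have hpos : 0 < traceNorm A :=
      (Finset.sum_nonneg fun i _ => LinearMap.singularValues_nonneg _ _).trans_lt hAN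
    rw [h]
    exact (div_lt_one hpos).2 hAN
  have hub : traceContraction N ∈ upperBounds (qfiRatios N) := by
    rintro r ⟨σ, θ, hσ, h0, rfl⟩
    obtain ⟨w, hw1, hw⟩ := hσ.self_of_nhds.1.exists_eq_ofBloch
    have hnonneg : 0 ≤ qfi σ θ := by
      obtain ⟨b, -, hF⟩ := exists_qfi_eq hσ hw
      have h2 : |inner ℝ b w| ≤ ‖b‖ :=
        (abs_real_inner_le_norm b w).trans (mul_le_of_le_one_right (norm_nonneg _) hw1)
      rw [hF]
      exact sub_nonneg.2 (sq_le_sq.2 (by rwa [abs_of_nonneg (norm_nonneg b)]))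
    rw [div_le_iff₀ (lt_of_le_of_ne hnonneg h0.symm)]
    refine hN.qfi_map_le ?_ hlt.le (fun x => ?_) hσ
    · rw [hs]
      exact LinearMap.singularValues_nonneg _ _
    · rw [hs]
      exact LinearMap.norm_apply_le_singularValues_zero _ x
  have hne := qfiRatios_nonempty N
  have hle : qfiContraction N ≤ traceContraction N := csSup_le hne hub
  exact ⟨⟨hne, _, hub⟩, hg, hle, hs, hlt, hle.trans_lt hlt⟩


end
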